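/- All graphs are finite and simple; the diameter of a disconnected graph is $\infty$. A graph is outerplanar if it can be drawn without crossings in a closed disc, edges being drawn as arcs, with all its vertices on the boundary circle of the disc. A completion of a graph $G$ is a graph on the same vertex set containing all edges of $G$, and $\mathbf{opdi}(G)$ denotes the minimum diameter of an outerplanar completion of $G$ (with $\mathbf{opdi}(G)=\infty$ if there is none). For a family $X$ of graphs and $i\in\mathbb{N}$, let $iX$ be the family of all disjoint unions of $i$ (not necessarily distinct) graphs of $X$, and let $\operatorname{join}(v,iX)$ be the family of all graphs obtained by taking $i$ graphs of $X$ and a new vertex $v$ and connecting each of the $i$ graphs to $v$ by a single edge (ending at an arbitrary vertex of that graph). Define families $A_i$ ($i\ge 0$) and $B_i$ ($i\ge 0$) by $$A_0=\{2K_1\},\qquad A_i=\begin{cases}2B_{i-1} & \text{if } i\ge 1 \text{ is even},\\ 2A_{i-1} & \text{if } i \text{ is odd},\end{cases}$$ $$B_1=\{K_{1,3}\},\qquad B_i=\begin{cases}\emptyset & \text{if } i \text{ is even},\\ \operatorname{join}(v,3B_{i-2}) & \text{if } i\ge 3 \text{ is odd}.\end{cases}$$ **Theorem.** Let $D\in\mathbb{N}=\{0,1,2,\dots\}$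 and let $G$ be an outerplanar graph that contains a graph from $A_D\cup B_D$ as a minor. Then $G$ has diameter at least $D+1$, and moreover $\mathbf{opdi}(G)>D$. In particular, every graph $H\in A_D\cup B_D$ satisfies $\mathbf{opdi}(H)>D$, that is, $H$ is a diameter-$D$ obstruction. -/

import Mathlib

namespace OPDI

/-- An outerplanar drawing of `G`: a drawing in the closed unit disc of the plane, without
crossings, in which all vertices lie on the bounding circle (hence on the outer face). Every edge
is drawn as an arc, i.e. an injective continuous curve joining its two ends; an arc passes through
no other vertex, and two arcs meet at most in a common end. -/
structure OuterplanarDrawing {V : Type*} (G : SimpleGraph V) where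
  /-- the point at which a vertex is drawn -/
  pos : V → ℂ
  /-- the point set of the curve that draws an edge (irrelevant off the edge set) -/
  arc : Sym2 V → Set ℂ
  pos_injective : Function.Injective pos
  pos_mem : ∀ v, pos v ∈ Metric.sphere (0 : ℂ) 1
  arc_subset : ∀ e ∈ G.edgeSet, arc e ⊆ Metric.closedBall (0 : ℂ) 1
  exists_path : ∀ u v, G.Adj u v →
    ∃ γ : Path (pos u) (pos v), Function.Injective γ ∧ Set.range γ = arc s(u, v)
  mem_of_pos_mem : ∀ e ∈ G.edgeSet, ∀ w, pos w ∈ arc e → w ∈ e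
  inter_subset : ∀ e ∈ G.edgeSet, ∀ e' ∈ G.edgeSet, e ≠ e' →
    ∀ z ∈ arc e ∩ arc e', ∃ w, w ∈ e ∧ w ∈ e' ∧ pos w = z

/-- A graph is outerplanar if it has an outerplanar drawing. -/
def IsOuterplanar {V : Type*} (G : SimpleGraph V) : Prop :=
  Nonempty (OuterplanarDrawing G)

/-- `H` is a minor of `G`: there are pairwise disjoint, (nonempty) connected branch sets in `G`,
one for each vertex of `H`, with an edge of `G` between the branch sets of any two adjacent
vertices of `H`. -/
def IsMinor {W V : Type*} (H : SimpleGraph W) (G : SimpleGraph V) : Prop :=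
  ∃ β : W → Set V,
    (∀ w, (G.induce (β w)).Connected) ∧
    (∀ w w', w ≠ w' → Disjoint (β w) (β w')) ∧
    (∀ w w', H.Adj w w' → ∃ x ∈ β w, ∃ y ∈ β w', G.Adj x y)

/-- `opdi G`: the least diameter of an outerplanar completion of `G`, a completion being a graph
on the same vertex set that contains all edges of `G`. The diameter of a disconnected graph
is infinite. -/
noncomputable def opdi {V : Type*} (G : SimpleGraph V) : ℕ∞ :=
  sInf {d : ℕ∞ | ∃ G' : SimpleGraph V, G ≤ G' ∧ IsOuterplanar G' ∧ G'.ediam = d}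

/-- A graph together with its vertex type. -/
structure Gr where
  V : Type
  graph : SimpleGraph V

/-- The disjoint union of a family of graphs. -/
def disjointUnion {i : ℕ} (F : Fin i → Gr) : Gr where
  V := Σ j, (F j).V
  graph :=
    { Adj := fun x y => ∃ (j : Fin i) (a b : (F j).V),
        x = ⟨j, a⟩ ∧ y = ⟨j, b⟩ ∧ (F j).graph.Adj a b
      symm := ⟨by
        rintro _ _ ⟨j, a, b, rfl, rfl, h⟩
        exact ⟨j, b, a, rfl, rfl, h.symm⟩⟩
      loopless := ⟨by
        rintro _ ⟨j, a, b, rfl, h, hab⟩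
        obtain rfl : a = b := by simpa using h
        exact hab.ne rfl⟩ }

/-- The disjoint union of the graphs `F j` and a new vertex `v = none`, with one further edge for
each `j`, which joins `v` to the vertex `a j` of the `j`-th graph. -/
def joinVertex {i : ℕ} (F : Fin i → Gr) (a : ∀ j, (F j).V) : Gr where
  V := Option (disjointUnion F).V
  graph :=
    { Adj := fun x y =>
        (∃ p q, x = some p ∧ y = some q ∧ (disjointUnion F).graph.Adj p q) ∨
        (∃ j, x = none ∧ y = some ⟨j, a j⟩) ∨
        (∃ j, x = some ⟨j, a j⟩ ∧ y = none)
      symm := ⟨by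
        rintro _ _ (⟨p, q, rfl, rfl, h⟩ | ⟨j, rfl, rfl⟩ | ⟨j, rfl, rfl⟩)
        · exact Or.inl ⟨q, p, rfl, rfl, h.symm⟩
        · exact Or.inr (Or.inr ⟨j, rfl, rfl⟩)
        · exact Or.inr (Or.inl ⟨j, rfl, rfl⟩)⟩
      loopless := ⟨by
        rintro _ (⟨p, q, rfl, h, hpq⟩ | ⟨j, rfl, h⟩ | ⟨j, rfl, h⟩)
        · obtain rfl : p = q := by simpa using h
          exact hpq.ne rfl
        · cases h
        · cases h⟩ }

/-- `iX`: the disjoint unions of `i` (not necessarily distinct) graphs of the family `X`. -/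
def copies (i : ℕ) (X : Set Gr) : Set Gr :=
  {K | ∃ F : Fin i → Gr, (∀ j, F j ∈ X) ∧ K = disjointUnion F}

/-- `join(v, iX)`: all graphs obtained from `i` graphs of the family `X` and a new vertex `v` by
connecting each of the `i` graphs to `v` by a single edge. -/
def joinCopies (i : ℕ) (X : Set Gr) : Set Gr :=
  {K | ∃ (F : Fin i → Gr) (a : ∀ j, (F j).V), (∀ j, F j ∈ X) ∧ K = joinVertex F a}

/-- The edgeless graph on two vertices. -/
def twoK1 : Gr := ⟨Fin 2, ⊥⟩

/-- The star with three leaves. -/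
def K13 : Gr := ⟨Fin 1 ⊕ Fin 3, completeBipartiteGraph (Fin 1) (Fin 3)⟩

/-- The families `B_i`. -/
def famB : ℕ → Set Gr
  | 0 => ∅
  | 1 => {K13}
  | i + 2 => if 2 ∣ i + 2 then ∅ else joinCopies 3 (famB i)

/-- The families `A_i`. -/
def famA : ℕ → Set Gr
  | 0 => {twoK1}
  | i + 1 => if 2 ∣ i + 1 then copies 2 (famB i) else copies 2 (famA i)

end OPDI

/-! An outerplanar drawing orders the vertices around a circle, and disjoint connected sets do not
interlace in this order (`exists_eq_of_interlaced`, `NonCrossing.not_interlaced`). Once the circle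
is cut open, each set spans an interval, its `hull`. The key fact is `Supports.exists_deep`: a set
carrying the `k`-fold iterated join has a vertex from which no walk of length at most `k` leaves the
hull. Indeed, of three joined copies, the middle one is shielded by the connected union of the
centre and the outer two.

A minor from the families yields, for `D = 2 * k`, two disjoint such sets. Their hulls can be made
disjoint, so their deep vertices are more than `2 * k` apart. For `D = 2 * k + 1` it yields either
four such sets or one of level `k + 1`. A walk of length at most `2 * k + 1` between two deep
vertices has no vertex outside both hulls. With four sets, two interlaced walks of this kind would
have to meet; at level `k + 1`, the centre with the middle copy would separate the outer two.
Completions keep minors, so the bound on the diameter also bounds `opdi`. -/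

namespace OPDI

/-! ### Topology: interlaced curves in the disc meet. -/

open Complex ComplexConjugate

/-- A continuous logarithm of `c * (1 - u t)`, with `u` in the closed unit disc and avoiding `1`,
changes by as much as the principal logarithm of `1 - u t`. -/
lemma sub_eq_log_sub_log {L u : ℝ → ℂ} {c : ℂ} (hL : Continuous L) (hu : Continuous u)
    (hexp : ∀ t, exp (L t) = c * (1 - u t)) (hle : ∀ t, ‖u t‖ ≤ 1) (hne : ∀ t, u t ≠ 1) (x y : ℝ) :
    L y - L x = log (1 - u y) - log (1 - u x) := by
  -- The real part of `1 - u t` is nonnegative, and it vanishes only at the excluded value `u t =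
  -- 1`.
  have hslit : ∀ t, 1 - u t ∈ slitPlane := by
    intro t
    rw [mem_slitPlane_iff]
    by_contra! h
    have him : (u t).im = 0 := by simpa using h.2
    have hre : 1 ≤ (u t).re := by simpa using h.1
    have hre' : (u t).re = 1 := le_antisymm ((re_le_norm _).trans (hle t)) hre
    exact hne t (Complex.ext (by simpa using hre') (by simpa using him))
  have hcont : Continuous fun t => L t - log (1 - u t) :=
    hL.sub (Continuous.clog (by fun_prop) hslit)
  -- Both sides lift the constant `c` through the covering `exp` and agree at `x`.
  have key : (fun t => L t - log (1 - u t)) = fun _ => L x - log (1 - u x) := by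
    refine isCoveringMap_exp.eq_of_comp_eq hcont continuous_const ?_ x rfl
    have hc : ∀ t, exp (L t - log (1 - u t)) = c := fun t => by
      rw [exp_sub, hexp, exp_log (slitPlane_ne_zero (hslit t)),
        mul_div_cancel_right₀ _ (slitPlane_ne_zero (hslit t))]
    funext t
    exact Subtype.ext ((hc t).trans (hc x).symm)
  have := congrFun key y
  linear_combination this

/-- Half-angle formula: `1 - exp (θ * I)` is `2 * sin (θ / 2)` times the unit vector at angle `(θ -
π) / 2`. -/
lemma arg_one_sub_exp {θ : ℝ} (h0 : 0 < θ) (h1 : θ < 2 * Real.pi) :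
    arg (1 - exp (θ * I)) = (θ - Real.pi) / 2 := by
  have hs : 0 < 2 * Real.sin (θ / 2) :=
    mul_pos two_pos (Real.sin_pos_of_pos_of_lt_pi (by linarith) (by linarith))
  have key : 1 - exp (θ * I) = ((2 * Real.sin (θ / 2) : ℝ) : ℂ) *
      (cos (((θ - Real.pi) / 2 : ℝ) : ℂ) + sin (((θ - Real.pi) / 2 : ℝ) : ℂ) * I) := by
    have e1 : (θ - Real.pi) / 2 = θ / 2 - Real.pi / 2 := by ring
    rw [← ofReal_cos, ← ofReal_sin, e1, Real.cos_sub_pi_div_two, Real.sin_sub_pi_div_two,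
      exp_mul_I, ← ofReal_cos, ← ofReal_sin]
    have e2 : Real.cos θ = 1 - 2 * Real.sin (θ / 2) ^ 2 := by
      have := Real.cos_two_mul (θ / 2)
      rw [mul_div_cancel₀ θ two_ne_zero] at this
      have := Real.sin_sq_add_cos_sq (θ / 2)
      linarith
    have e3 : Real.sin θ = 2 * Real.sin (θ / 2) * Real.cos (θ / 2) := by
      have := Real.sin_two_mul (θ / 2)
      rwa [mul_div_cancel₀ θ two_ne_zero] at this
    rw [e2, e3]
    push_cast
    ring
  rw [key, arg_mul_cos_add_sin_mul_I hs ⟨by linarith, by linarith⟩]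

/-- Two curves in the closed unit disc which join interlaced pairs of points of the unit circle
have a common point. -/
theorem exists_eq_of_interlaced {γ δ : ℝ → ℂ} (hγ : Continuous γ) (hδ : Continuous δ)
    (hγ1 : ∀ t, ‖γ t‖ ≤ 1) (hδ1 : ∀ t, ‖δ t‖ ≤ 1) {α β α' β' : ℝ}
    (h1 : α < β) (h2 : β < α') (h3 : α' < β') (h4 : β' < α + 2 * Real.pi)
    (hα : γ 0 = exp (α * I)) (hα' : γ 1 = exp (α' * I))
    (hβ : δ 0 = exp (β * I)) (hβ' : δ 1 = exp (β' * I)) : ∃ s t, γ s = δ t := by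
  by_contra! hne
  -- If the curves are disjoint, `γ s - δ t` never vanishes, so it has a continuous logarithm on the
  -- simply connected plane.
  obtain ⟨F, -, hF⟩ : ∃ F : C(ℝ × ℝ, ℂ), F 0 = log (γ 0 - δ 0) ∧
      exp ∘ F = fun p : ℝ × ℝ => γ p.1 - δ p.2 :=
    (isCoveringMapOn_exp.existsUnique_continuousMap_lifts (A := ℝ × ℝ)
      ⟨fun p => γ p.1 - δ p.2, by fun_prop⟩ (a₀ := 0)
      (exp_log (sub_ne_zero.2 (hne 0 0))) (fun p => sub_ne_zero.2 (hne p.1 p.2))).exists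
  have hF' : ∀ s t, exp (F (s, t)) = γ s - δ t := fun s t => congrFun hF (s, t)
  have unit : ∀ θ : ℝ, exp (θ * I) * conj (exp (θ * I)) = 1 := fun θ => by
    rw [mul_conj, normSq_eq_norm_sq, norm_exp_ofReal_mul_I]; simp
  have sideγ : ∀ (θ s : ℝ), γ s = exp (θ * I) → F (s, 1) - F (s, 0) =
      log (1 - conj (exp (θ * I)) * δ 1) - log (1 - conj (exp (θ * I)) * δ 0) := by
    intro θ s hs
    refine sub_eq_log_sub_log (L := fun t => F (s, t)) (u := fun t => conj (exp (θ * I)) * δ t)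
      (c := exp (θ * I)) (by fun_prop) (by fun_prop) (fun t => ?_) (fun t => ?_) (fun t h => ?_) 0 1
    · rw [hF', hs]; linear_combination δ t * unit θ
    · rw [norm_mul, RCLike.norm_conj, norm_exp_ofReal_mul_I, one_mul]; exact hδ1 t
    · apply hne s t
      rw [hs]; linear_combination exp (θ * I) * (-h) + δ t * unit θ
  have sideδ : ∀ (θ t : ℝ), δ t = exp (θ * I) → F (1, t) - F (0, t) =
      log (1 - conj (exp (θ * I)) * γ 1) - log (1 - conj (exp (θ * I)) * γ 0) := by
    intro θ t ht
    refine sub_eq_log_sub_log (L := fun s => F (s, t)) (u := fun s => conj (exp (θ * I)) * γ s)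
      (c := - exp (θ * I)) (by fun_prop) (by fun_prop) (fun s => ?_) (fun s => ?_)
      (fun s h => ?_) 0 1
    · rw [hF', ht]; linear_combination (γ s) * (- unit θ)
    · rw [norm_mul, RCLike.norm_conj, norm_exp_ofReal_mul_I, one_mul]; exact hγ1 s
    · apply hne s t
      rw [ht]; linear_combination exp (θ * I) * h - γ s * unit θ
  have hmul : ∀ x y : ℝ, conj (exp (x * I)) * exp (y * I) = exp ((y - x : ℝ) * I) := fun x y => by
    rw [← exp_conj, ← exp_add]; simp; ring_nf
  have argpos : ∀ x y : ℝ, x < y → y < x + 2 * Real.pi →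
      (log (1 - conj (exp (x * I)) * exp (y * I))).im = (y - x - Real.pi) / 2 := fun x y h h' => by
    rw [hmul, log_im, arg_one_sub_exp (by linarith) (by linarith)]
  have argneg : ∀ x y : ℝ, x < y → y < x + 2 * Real.pi →
      (log (1 - conj (exp (y * I)) * exp (x * I))).im = - (y - x - Real.pi) / 2 := fun x y h h' => by
    have e : exp ((x - y : ℝ) * I) = exp ((x - y + 2 * Real.pi : ℝ) * I) := by
      push_cast
      rw [add_mul, exp_add, exp_two_pi_mul_I, mul_one]
    rw [hmul, log_im, e, arg_one_sub_exp (by linarith) (by linarith)]; ring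
  -- The imaginary part of `F` changes by computable amounts along the sides of the unit square; the
  -- two ways from `(0, 0)` to `(1, 1)` disagree by `2π`.
  have s1 := congrArg im (sideγ α 0 hα)
  have s2 := congrArg im (sideγ α' 1 hα')
  have s3 := congrArg im (sideδ β 0 hβ)
  have s4 := congrArg im (sideδ β' 1 hβ')
  rw [hβ, hβ', sub_im, sub_im, argpos _ _ (by linarith) (by linarith),
    argpos _ _ (by linarith) (by linarith)] at s1
  rw [hβ, hβ', sub_im, sub_im, argpos _ _ (by linarith) (by linarith),
    argneg _ _ (by linarith) (by linarith)] at s2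
  rw [hα, hα', sub_im, sub_im, argpos _ _ (by linarith) (by linarith),
    argneg _ _ (by linarith) (by linarith)] at s3
  rw [hα, hα', sub_im, sub_im, argneg _ _ (by linarith) (by linarith),
    argneg _ _ (by linarith) (by linarith)] at s4
  linarith [Real.pi_pos]

/-! ### Non-crossing orders: interlacing, cutting open, hulls. -/

/-- `f` places the vertices of `G` on a line in such a way that edges, drawn as half circles
on one side of the line, do not cross. -/
structure NonCrossing {V : Type*} (G : SimpleGraph V) (f : V → ℝ) : Prop where
  injective : Function.Injective f
  not_adj : ∀ ⦃a b c d⦄, f a < f b → f b < f c → f c < f d → G.Adj a c → ¬ G.Adj b d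

/-- Order the vertices by argument. Arcs with interlaced ends would meet, hence share an end, but
the four ends are distinct. -/
theorem IsOuterplanar.exists_nonCrossing {V : Type*} {G : SimpleGraph V} (h : IsOuterplanar G) :
    ∃ f : V → ℝ, NonCrossing G f := by
  obtain ⟨D⟩ := h
  have hpos : ∀ v, D.pos v = exp (arg (D.pos v) * I) := fun v => by
    have h1 : ‖D.pos v‖ = 1 := by simpa using D.pos_mem v
    conv_lhs => rw [← norm_mul_exp_arg_mul_I (D.pos v), h1]
    simp
  refine ⟨fun v => arg (D.pos v), ⟨fun v w hvw => D.pos_injective ?_, ?_⟩⟩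
  · rw [hpos v, hpos w]
    exact congrArg (fun x : ℝ => exp (x * I)) hvw
  · intro a b c d hab hbc hcd hac hbd
    obtain ⟨γ, -, hγ⟩ := D.exists_path a c hac
    obtain ⟨δ, -, hδ⟩ := D.exists_path b d hbd
    have hγm : ∀ t, γ.extend t ∈ D.arc s(a, c) := fun t => by
      rw [← hγ, ← γ.extend_range]; exact ⟨t, rfl⟩
    have hδm : ∀ t, δ.extend t ∈ D.arc s(b, d) := fun t => by
      rw [← hδ, ← δ.extend_range]; exact ⟨t, rfl⟩
    obtain ⟨s, t, hst⟩ := exists_eq_of_interlaced γ.continuous_extend δ.continuous_extend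
      (fun t => by simpa using D.arc_subset _ hac (hγm t))
      (fun t => by simpa using D.arc_subset _ hbd (hδm t)) hab hbc hcd
      (by linarith [arg_le_pi (D.pos d), neg_pi_lt_arg (D.pos a)])
      (by rw [γ.extend_zero]; exact hpos a) (by rw [γ.extend_one]; exact hpos c)
      (by rw [δ.extend_zero]; exact hpos b) (by rw [δ.extend_one]; exact hpos d)
    have key : ∀ w, w ∈ s(a, c) → w ∈ s(b, d) → False := by
      intro w h1 h2
      rw [Sym2.mem_iff] at h1 h2
      rcases h1 with rfl | rfl <;> rcases h2 with rfl | rfl <;> linarith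
    obtain ⟨w, hw1, hw2, -⟩ := D.inter_subset _ hac _ hbd
      (fun h => key a (by simp) (by rw [← h]; simp)) (γ.extend s) ⟨hγm s, hst ▸ hδm t⟩
    exact key w hw1 hw2

end OPDI

namespace OPDI

variable {V : Type*} {G : SimpleGraph V} {f : V → ℝ}

open SimpleGraph

lemma exists_adj_of_connected {S : Set V} (hS : (G.induce S).Connected) {s s' : V} (hs : s ∈ S)
    (hs' : s' ∈ S) {P : V → Prop} (h : P s) (h' : ¬ P s') :
    ∃ u ∈ S, ∃ w ∈ S, G.Adj u w ∧ P u ∧ ¬ P w := by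
  obtain ⟨p⟩ := hS ⟨s, hs⟩ ⟨s', hs'⟩
  obtain ⟨d, -, h1, h2⟩ := p.exists_boundary_dart {v | P v.1} h h'
  exact ⟨d.fst, d.fst.2, d.snd, d.snd.2, d.adj, h1, h2⟩

/-- Disjoint connected sets do not interlace. -/
lemma NonCrossing.not_interlaced (hf : NonCrossing G f) {S T : Set V}
    (hS : (G.induce S).Connected) (hT : (G.induce T).Connected) (hd : Disjoint S T)
    {s s' t t' : V} (hs : s ∈ S) (ht : t ∈ T) (hs' : s' ∈ S) (ht' : t' ∈ T)
    (h1 : f s < f t) (h2 : f t < f s') (h3 : f s' < f t') : False := by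
  have ne : ∀ {a b}, a ∈ S → b ∈ T → f a ≠ f b := fun ha hb h =>
    Set.disjoint_left.1 hd ha (hf.injective h ▸ hb)
  -- Some edge `uw` of `S` enters the interval from `t` to `t'`. It has exactly one of `t`, `t'`
  -- between its ends, so an edge of `T` crosses it.
  obtain ⟨u, hu, w, hw, huw, hPu, hPw⟩ := exists_adj_of_connected hS hs hs'
    (P := fun v => f v < f t ∨ f t' < f v) (Or.inl h1) (by push Not; exact ⟨h2.le, h3.le⟩)
  push Not at hPw
  have hw1 := lt_of_le_of_ne hPw.1 (ne hw ht).symm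
  have hw2 := lt_of_le_of_ne hPw.2 (ne hw ht')
  rcases hPu with hPu | hPu
  · obtain ⟨a, ha, b, hb, hab, hQa, hQb⟩ := exists_adj_of_connected hT ht ht'
      (P := fun v => f u < f v ∧ f v < f w) ⟨hPu, hw1⟩ (fun h => by linarith [h.2])
    rcases lt_or_gt_of_ne (ne hu hb) with h | h
    · rcases lt_or_gt_of_ne (ne hw hb) with h' | h'
      · exact hf.not_adj hQa.1 hQa.2 h' huw hab
      · exact hQb ⟨h, h'⟩
    · exact hf.not_adj h hQa.1 hQa.2 hab.symm huw
  · obtain ⟨a, ha, b, hb, hab, hQa, hQb⟩ := exists_adj_of_connected hT ht' ht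
      (P := fun v => f w < f v ∧ f v < f u) ⟨hw2, hPu⟩ (fun h => by linarith [h.1])
    rcases lt_or_gt_of_ne (ne hw hb) with h | h
    · rcases lt_or_gt_of_ne (ne hu hb) with h' | h'
      · exact hf.not_adj hQa.1 hQa.2 h' huw.symm hab
      · exact hQb ⟨h, h'⟩
    · exact hf.not_adj h hQa.1 hQa.2 hab.symm huw.symm

/-- The circular order of the vertices may be cut open at any point. -/
lemma NonCrossing.exists_rotate (hf : NonCrossing G f) (c : ℝ) :
    ∃ f' : V → ℝ, NonCrossing G f' ∧ ∀ v w, f' v < f' w ↔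
      (c ≤ f v ∧ f w < c) ∨ (f v < f w ∧ (f w < c ∨ c ≤ f v)) := by
  -- `arctan` makes the order bounded, with range of length `π < 4`, so a shift by `10` moves
  -- everything before `c` past the rest.
  let f' : V → ℝ := fun v => Real.arctan (f v) + if f v < c then 10 else 0
  have hlt : ∀ v w, f' v < f' w ↔
      (c ≤ f v ∧ f w < c) ∨ (f v < f w ∧ (f w < c ∨ c ≤ f v)) := by
    intro v w
    have hv := Real.neg_pi_div_two_lt_arctan (f v)
    have hv' := Real.arctan_lt_pi_div_two (f v)
    have hw := Real.neg_pi_div_two_lt_arctan (f w)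
    have hw' := Real.arctan_lt_pi_div_two (f w)
    have hpi := Real.pi_lt_four
    have := Real.arctan_strictMono.lt_iff_lt (a := f v) (b := f w)
    simp only [f']
    rw [← this]
    constructor
    · intro h
      split_ifs at h with h1 h2 h2
      · exact Or.inr ⟨by linarith, Or.inl h2⟩
      · linarith
      · exact Or.inl ⟨not_lt.1 h1, h2⟩
      · exact Or.inr ⟨by linarith, Or.inr (not_lt.1 h1)⟩
    · rintro (⟨h1, h2⟩ | ⟨h, h1 | h1⟩)
      · rw [if_neg (not_lt.2 h1), if_pos h2]; linarith
      · rw [if_pos ((this.1 h).trans h1), if_pos h1]; linarith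
      · rw [if_neg (not_lt.2 h1), if_neg (not_lt.2 (h1.trans (this.1 h).le))]; linarith
  refine ⟨f', ⟨?_, ?_⟩, hlt⟩
  · intro v w h
    have h1 := (not_congr (hlt v w)).1 h.not_lt
    have h2 := (not_congr (hlt w v)).1 h.symm.not_lt
    push Not at h1 h2
    apply hf.injective
    by_contra hne
    rcases lt_or_gt_of_ne hne with h | h
    · have := h1.2 h; have := h2.1 this.1; linarith
    · have := h2.2 h; have := h1.1 this.1; linarith
  · intro a b c d hab hbc hcd hac hbd
    rw [hlt] at hab hbc hcd
    -- Crossing is invariant under cyclic rotation: the alternatives below are the four places where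
    -- the cut can fall.
    rcases hab with ⟨ha1, ha2⟩ | ⟨ha1, ha2 | ha2⟩ <;>
      rcases hbc with ⟨hb1, hb2⟩ | ⟨hb1, hb2 | hb2⟩ <;>
      rcases hcd with ⟨hc1, hc2⟩ | ⟨hc1, hc2 | hc2⟩ <;>
      first
      | linarith
      | exact hf.not_adj (by linarith) (by linarith) (by linarith) hac hbd
      | exact hf.not_adj (by linarith) (by linarith) (by linarith) hbd hac.symm
      | exact hf.not_adj (by linarith) (by linarith) (by linarith) hac.symm hbd.symm
      | exact hf.not_adj (by linarith) (by linarith) (by linarith) hbd.symm hac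

/-- The set of vertices that lie between two vertices of `X`. -/
def hull (f : V → ℝ) (X : Set V) : Set V := {v | (∃ x ∈ X, f x ≤ f v) ∧ ∃ x ∈ X, f v ≤ f x}

lemma subset_hull (f : V → ℝ) (X : Set V) : X ⊆ hull f X :=
  fun x hx => ⟨⟨x, hx, le_rfl⟩, x, hx, le_rfl⟩

lemma disjoint_hull {X Y : Set V} (h1 : ∀ y ∈ Y, y ∉ hull f X) (h2 : ∀ x ∈ X, x ∉ hull f Y) :
    Disjoint (hull f X) (hull f Y) := by
  rw [Set.disjoint_left]
  rintro v ⟨⟨a, ha, hav⟩, a', ha', hva'⟩ ⟨⟨b, hb, hbv⟩, b', hb', hvb'⟩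
  rcases le_total (f a) (f b) with h | h
  · exact h1 b hb ⟨⟨a, ha, h⟩, a', ha', hbv.trans hva'⟩
  · exact h2 a ha ⟨⟨b, hb, h⟩, b', hb', hav.trans hvb'⟩

/-! ### Deep vertices. -/

/-- Every walk in `G` from `x` to a vertex outside `I` has length greater than `k`. -/
def Deep (G : SimpleGraph V) (k : ℕ) (I : Set V) (x : V) : Prop :=
  ∀ y, y ∉ I → ∀ p : G.Walk x y, k + 1 ≤ p.length

lemma Deep.mem {k : ℕ} {I : Set V} {x : V} (h : Deep G k I x) : x ∈ I := by
  by_contra hx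
  simpa using h x hx Walk.nil

/-- Each of the two pieces into which `z` splits the walk has length at least `k + 1`. -/
lemma Deep.length_of_mem_support {k : ℕ} {I J : Set V} {x y z : V} (hx : Deep G k I x)
    (hy : Deep G k J y) (p : G.Walk x y) (hz : z ∈ p.support) (hI : z ∉ I) (hJ : z ∉ J) :
    2 * k + 2 ≤ p.length := by
  classical
  have h1 := hx z hI (p.takeUntil z hz)
  have h2 := hy z hJ (p.dropUntil z hz).reverse
  have h3 := congrArg Walk.length (p.take_spec hz)
  rw [Walk.length_append] at h3
  rw [Walk.length_reverse] at h2
  omega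

lemma Deep.mem_or_eq_of_mem_support {k : ℕ} {I : Set V} {x y z : V} (hx : Deep G k I x)
    (p : G.Walk x y) (hp : p.length ≤ k + 1) (hz : z ∈ p.support) : z ∈ I ∨ z = y := by
  classical
  by_contra! h
  have h1 := hx z h.1 (p.takeUntil z hz)
  have h3 := congrArg Walk.length (p.take_spec hz)
  rw [Walk.length_append] at h3
  exact h.2 (Walk.eq_of_length_eq_zero (p := p.dropUntil z hz) (by omega))

/-- On a shorter walk, the vertex at step `k` is within `k` steps of both ends, hence in `I` and in
`J`. -/
lemma Deep.length_of_disjoint {k : ℕ} {I J : Set V} {x y : V} (hx : Deep G k I x)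
    (hy : Deep G k J y) (hIJ : Disjoint I J) (p : G.Walk x y) : 2 * k + 1 ≤ p.length := by
  by_contra! h
  have h1 : p.getVert k ∈ I := by
    by_contra hn
    have := hx _ hn (p.take k)
    rw [Walk.take_length] at this
    omega
  have h2 : p.getVert k ∈ J := by
    by_contra hn
    have := hy _ hn (p.drop k).reverse
    rw [Walk.length_reverse, Walk.drop_length] at this
    omega
  exact Set.disjoint_left.1 hIJ h1 h2

/-- `X` is the vertex set of a minor model of the `k`-th graph in the sequence that starts with
`K₁` and continues by joining three copies of a graph of the sequence to a new vertex. -/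
def Supports (G : SimpleGraph V) : ℕ → Set V → Prop
  | 0, X => (G.induce X).Connected
  | k + 1, X => ∃ (X₀ : Set V) (Y : Fin 3 → Set V), X = X₀ ∪ ⋃ i, Y i ∧
      (G.induce X₀).Connected ∧ (∀ i, Supports G k (Y i)) ∧ (∀ i, Disjoint X₀ (Y i)) ∧
      (∀ i j, i ≠ j → Disjoint (Y i) (Y j)) ∧ ∀ i, ∃ x ∈ X₀, ∃ y ∈ Y i, G.Adj x y

lemma connected_union_union {X Y Z : Set V} (hXY : (G.induce (X ∪ Y)).Connected)
    (hXZ : (G.induce (X ∪ Z)).Connected) (hX : X.Nonempty) :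
    (G.induce (Y ∪ X ∪ Z)).Connected := by
  have := induce_union_connected hXY.preconnected hXZ.preconnected
    (hX.mono fun x hx => ⟨Or.inl hx, Or.inl hx⟩)
  have e : Y ∪ X ∪ Z = X ∪ Y ∪ (X ∪ Z) := by
    ext; simp only [Set.mem_union]; tauto
  rwa [e]

lemma Supports.connected {k : ℕ} {X : Set V} (h : Supports G k X) : (G.induce X).Connected := by
  induction k generalizing X with
  | zero => exact h
  | succ k ih =>
    obtain ⟨X₀, Y, rfl, h0, hY, -, -, hadj⟩ := h
    have h1 : ∀ i, (G.induce (X₀ ∪ Y i)).Connected := fun i => by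
      obtain ⟨x, hx, y, hy, hxy⟩ := hadj i
      exact connected_induce_union h0.preconnected (ih (hY i)).preconnected hx hy hxy
    have hne : X₀.Nonempty := Set.nonempty_coe_sort.1 h0.nonempty
    have := induce_union_connected (connected_union_union (h1 0) (h1 1) hne).preconnected
      (h1 2).preconnected (hne.mono fun x hx => ⟨Or.inl (Or.inr hx), Or.inl hx⟩)
    have e : X₀ ∪ ⋃ i, Y i = Y 0 ∪ X₀ ∪ Y 1 ∪ (X₀ ∪ Y 2) := by
      ext v
      simp only [Set.mem_union, Set.mem_iUnion, Fin.exists_fin_succ]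
      simp
      tauto
    rwa [e]

lemma Supports.nonempty {k : ℕ} {X : Set V} (h : Supports G k X) : X.Nonempty :=
  Set.nonempty_coe_sort.1 h.connected.nonempty

lemma exists_strictMono_comp_perm {n : ℕ} (g : Fin n → ℝ) (hg : Function.Injective g) :
    ∃ σ : Equiv.Perm (Fin n), StrictMono (g ∘ σ) :=
  ⟨Tuple.sort g, (Tuple.monotone_sort g).strictMono_of_injective
    (hg.comp (Tuple.sort g).injective)⟩

lemma NonCrossing.exists_strictMono (hf : NonCrossing G f) {n : ℕ} {X : Fin n → Set V}
    (hX : ∀ i j, i ≠ j → Disjoint (X i) (X j)) {x : Fin n → V} (hx : ∀ i, x i ∈ X i) :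
    ∃ σ : Equiv.Perm (Fin n), StrictMono fun i => f (x (σ i)) := by
  refine exists_strictMono_comp_perm (fun i => f (x i)) fun i j hij => ?_
  by_contra hne
  exact Set.disjoint_left.1 (hX i j hne) (hx i) (hf.injective hij ▸ hx j)

/-- A deep vertex of the middle copy gains one step: a walk of length at most `k + 1` stays in the
hull of that copy until its last vertex. It thus avoids the connected set `S`, which surrounds its
start, and cannot end beyond the hull of `X`. -/
theorem Supports.exists_deep (hf : NonCrossing G f) {k : ℕ} {X : Set V} (h : Supports G k X) :
    ∃ x, Deep G k (hull f X) x := by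
  induction k generalizing X with
  | zero =>
    obtain ⟨x, hx⟩ := h.nonempty
    refine ⟨x, fun y hy p => ?_⟩
    by_contra! hp
    obtain rfl := Walk.eq_of_length_eq_zero (p := p) (by omega)
    exact hy (subset_hull f X hx)
  | succ k ih =>
    have hsup := h
    obtain ⟨X₀, Y, hX, h0, hY, hd0, hd, hadj⟩ := h
    choose q hq using fun i => (hY i).nonempty
    obtain ⟨σ, hσ⟩ := hf.exists_strictMono hd hq
    have hab : f (q (σ 0)) < f (q (σ 1)) := hσ (by decide)
    have hbc : f (q (σ 1)) < f (q (σ 2)) := hσ (by decide)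
    have hYX : ∀ i, Y i ⊆ X := fun i => by
      rw [hX]; exact (Set.subset_iUnion Y i).trans Set.subset_union_right
    have hcon : ∀ i, (G.induce (X₀ ∪ Y i)).Connected := fun i => by
      obtain ⟨x, hx, y, hy, hxy⟩ := hadj i
      exact connected_induce_union h0.preconnected (hY i).connected.preconnected hx hy hxy
    set S : Set V := Y (σ 0) ∪ X₀ ∪ Y (σ 2) with hS
    have hScon : (G.induce S).Connected :=
      connected_union_union (hcon _) (hcon _) (Set.nonempty_coe_sort.1 h0.nonempty)
    have hSX : S ⊆ X :=
      Set.union_subset (Set.union_subset (hYX _) (by rw [hX]; exact Set.subset_union_left)) (hYX _)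
    have hSd : Disjoint S (Y (σ 1)) := by
      simp only [hS, Set.disjoint_union_left]
      exact ⟨⟨hd _ _ (σ.injective.ne (by decide)), hd0 _⟩, hd _ _ (σ.injective.ne (by decide))⟩
    have haS : q (σ 0) ∈ S := Or.inl (Or.inl (hq _))
    have hcS : q (σ 2) ∈ S := Or.inr (hq _)
    have ne : ∀ {a b}, a ∈ S → b ∈ Y (σ 1) → f a ≠ f b := fun ha hb h =>
      Set.disjoint_left.1 hSd ha (hf.injective h ▸ hb)
    have hhull : ∀ s ∈ S, s ∉ hull f (Y (σ 1)) := by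
      rintro s hs ⟨⟨b, hb, hbs⟩, b', hb', hsb'⟩
      have h1 := lt_of_le_of_ne hbs (ne hs hb).symm
      have h2 := lt_of_le_of_ne hsb' (ne hs hb')
      rcases lt_or_gt_of_ne (ne haS hb) with h | h
      · exact hf.not_interlaced hScon (hY _).connected hSd haS hb hs hb' h h1 h2
      -- Here `Y (σ 1)` starts before `q (σ 0)`, so `q (σ 1)` and the two outer representatives
      -- already interlace.
      · exact hf.not_interlaced (hY _).connected hScon hSd.symm hb haS (hq _) hcS h hab hbc
    obtain ⟨x, hx⟩ := ih (hY (σ 1))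
    refine ⟨x, fun j hj p => ?_⟩
    by_contra! hp
    have hjX : j ∉ X := fun h => hj (subset_hull f X h)
    have hdisj : Disjoint S {v | v ∈ p.support} := by
      rw [Set.disjoint_left]
      intro s hs hsp
      rcases hx.mem_or_eq_of_mem_support p (by omega) hsp with h | rfl
      · exact hhull s hs h
      · exact hjX (hSX hs)
    have hxm : f (q (σ 0)) < f x ∧ f x < f (q (σ 2)) := by
      obtain ⟨⟨b, hb, hbx⟩, b', hb', hxb'⟩ := hx.mem
      refine ⟨?_, ?_⟩
      · by_contra! hle
        exact hhull _ haS ⟨⟨b, hb, hbx.trans hle⟩, _, hq _, hab.le⟩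
      · by_contra! hle
        exact hhull _ hcS ⟨⟨_, hq _, hbc.le⟩, b', hb', hle.trans hxb'⟩
    have hpx : x ∈ {v | v ∈ p.support} := p.start_mem_support
    have hpj : j ∈ {v | v ∈ p.support} := p.end_mem_support
    by_cases hja : f (q (σ 0)) ≤ f j
    · have hjc : f (q (σ 2)) < f j := by
        by_contra! hle
        exact hj ⟨⟨_, hSX haS, hja⟩, _, hSX hcS, hle⟩
      exact hf.not_interlaced hScon p.connected_induce_support hdisj haS hpx hcS hpj
        hxm.1 hxm.2 hjc
    · exact hf.not_interlaced p.connected_induce_support hScon hdisj.symm hpj haS hpx hcS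
        (not_le.1 hja) hxm.1 hxm.2

/-! ### Lower bounds on the diameter. -/

/-- The circular order of the vertices may be cut open before any given vertex. -/
lemma NonCrossing.exists_rotate_min (hf : NonCrossing G f) (z : V) :
    ∃ f' : V → ℝ, NonCrossing G f' ∧ (∀ v, f' z ≤ f' v) ∧ ∀ v w, f' v < f' w ↔
      (f z ≤ f v ∧ f w < f z) ∨ (f v < f w ∧ (f w < f z ∨ f z ≤ f v)) := by
  obtain ⟨g, hg, hlt⟩ := hf.exists_rotate (f z)
  refine ⟨g, hg, fun v => ?_, hlt⟩
  rw [← not_lt, hlt]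
  rintro (h | ⟨h, h' | h'⟩)
  · exact lt_irrefl _ h.2
  · exact lt_irrefl _ h'
  · exact lt_irrefl _ (h.trans_le h')

/-- In a graph of diameter at most `2 * k + 1`, no connected set separates two disjoint sets that
support the `k`-th graph: the case in which the separating set contains the leftmost vertex. -/
lemma NonCrossing.not_separated_of_le (hf : NonCrossing G f) {k : ℕ}
    (hG : ∀ u v, ∃ p : G.Walk u v, p.length ≤ 2 * k + 1) {X Y Z : Set V}
    (hZ : (G.induce Z).Connected) (hX : Supports G k X) (hY : Supports G k Y)
    (hZX : Disjoint Z X) (hZY : Disjoint Z Y) {z z' x y : V}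
    (hz : z ∈ Z) (hx : x ∈ X) (hz' : z' ∈ Z) (hy : y ∈ Y) (hmin : ∀ v, f z ≤ f v)
    (h1 : f x < f z') (h2 : f z' < f y) : False := by
  have hlt : ∀ {v}, v ∉ Z → f z < f v := fun hv =>
    lt_of_le_of_ne (hmin _) fun h => hv (hf.injective h ▸ hz)
  have nZX : ∀ {v}, v ∈ X → v ∉ Z := fun hv h => Set.disjoint_left.1 hZX h hv
  have nZY : ∀ {v}, v ∈ Y → v ∉ Z := fun hv h => Set.disjoint_left.1 hZY h hv
  have ne : ∀ {a b}, a ∈ Z → b ∉ Z → f a ≠ f b := fun ha hb h => hb (hf.injective h ▸ ha)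
  have hull_disj : ∀ {T : Set V} {j}, Supports G j T → Disjoint Z T → ∀ w ∈ Z, w ∉ hull f T := by
    rintro T j hT hZT w hw ⟨⟨b, hb, hbw⟩, b', hb', hwb'⟩
    have nb : b ∉ Z := fun h => Set.disjoint_left.1 hZT h hb
    have nb' : b' ∉ Z := fun h => Set.disjoint_left.1 hZT h hb'
    exact hf.not_interlaced hZ hT.connected hZT hz hb hw hb' (hlt nb)
      (lt_of_le_of_ne hbw (ne hw nb).symm) (lt_of_le_of_ne hwb' (ne hw nb'))
  obtain ⟨a, ha⟩ := hX.exists_deep hf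
  obtain ⟨b, hb⟩ := hY.exists_deep hf
  have haZ : a ∉ Z := fun h => hull_disj hX hZX a h ha.mem
  have hbZ : b ∉ Z := fun h => hull_disj hY hZY b h hb.mem
  have haz' : f a < f z' := by
    by_contra! hle
    obtain ⟨-, c, hc, hac⟩ := ha.mem
    exact hull_disj hX hZX z' hz' ⟨⟨x, hx, h1.le⟩, c, hc, hle.trans hac⟩
  have hz'b : f z' < f b := by
    by_contra! hle
    obtain ⟨⟨c, hc, hcb⟩, -⟩ := hb.mem
    exact hull_disj hY hZY z' hz' ⟨⟨c, hc, hcb.trans hle⟩, y, hy, h2.le⟩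
  obtain ⟨p, hp⟩ := hG a b
  -- `Z` misses both hulls, so meeting it would cost the walk `2 * k + 2` steps.
  have hdisj : Disjoint Z {v | v ∈ p.support} := by
    rw [Set.disjoint_left]
    intro w hw hwp
    have := ha.length_of_mem_support hb p hwp (hull_disj hX hZX w hw) (hull_disj hY hZY w hw)
    omega
  exact hf.not_interlaced hZ p.connected_induce_support hdisj hz p.start_mem_support hz'
    p.end_mem_support (hlt haZ) haz' hz'b

lemma NonCrossing.not_separated (hf : NonCrossing G f) {k : ℕ}
    (hG : ∀ u v, ∃ p : G.Walk u v, p.length ≤ 2 * k + 1) {X Y Z : Set V}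
    (hZ : (G.induce Z).Connected) (hX : Supports G k X) (hY : Supports G k Y)
    (hZX : Disjoint Z X) (hZY : Disjoint Z Y) {z z' x y : V}
    (hz : z ∈ Z) (hx : x ∈ X) (hz' : z' ∈ Z) (hy : y ∈ Y)
    (h1 : f z < f x) (h2 : f x < f z') (h3 : f z' < f y) : False := by
  obtain ⟨g, hg, hmin, hlt⟩ := hf.exists_rotate_min z
  refine hg.not_separated_of_le hG hZ hX hY hZX hZY hz hx hz' hy hmin ?_ ?_
  · exact (hlt _ _).2 (Or.inr ⟨h2, Or.inr h1.le⟩)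
  · exact (hlt _ _).2 (Or.inr ⟨h3, Or.inr (h1.trans h2).le⟩)

/-- Cutting before `z` puts `x` last, so `X` and `Y` swap roles. -/
lemma NonCrossing.not_separated' (hf : NonCrossing G f) {k : ℕ}
    (hG : ∀ u v, ∃ p : G.Walk u v, p.length ≤ 2 * k + 1) {X Y Z : Set V}
    (hZ : (G.induce Z).Connected) (hX : Supports G k X) (hY : Supports G k Y)
    (hZX : Disjoint Z X) (hZY : Disjoint Z Y) {z z' x y : V}
    (hz : z ∈ Z) (hx : x ∈ X) (hz' : z' ∈ Z) (hy : y ∈ Y)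
    (h1 : f x < f z) (h2 : f z < f y) (h3 : f y < f z') : False := by
  obtain ⟨g, hg, -, hlt⟩ := hf.exists_rotate_min z
  refine hg.not_separated hG hZ hY hX hZY hZX hz hy hz' hx ?_ ?_ ?_
  · exact (hlt _ _).2 (Or.inr ⟨h2, Or.inr le_rfl⟩)
  · exact (hlt _ _).2 (Or.inr ⟨h3, Or.inr h2.le⟩)
  · exact (hlt _ _).2 (Or.inl ⟨(h2.trans h3).le, h1⟩)

/-- With the cut at a vertex of the centre `X₀`, the centre and the middle copy together separate
the outer copies. -/
theorem NonCrossing.not_supports_succ (hf : NonCrossing G f) {k : ℕ} {X : Set V}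
    (hG : ∀ u v, ∃ p : G.Walk u v, p.length ≤ 2 * k + 1) : ¬ Supports G (k + 1) X := by
  rintro ⟨X₀, Y, -, h0, hY, hd0, hd, hadj⟩
  obtain ⟨z, hz⟩ := h0.nonempty
  obtain ⟨g, hg, hmin, -⟩ := hf.exists_rotate_min z
  choose q hq using fun i => (hY i).nonempty
  obtain ⟨σ, hσ⟩ := hg.exists_strictMono hd hq
  have h01 : σ 0 ≠ σ 1 := σ.injective.ne (by decide)
  have h12 : σ 1 ≠ σ 2 := σ.injective.ne (by decide)
  obtain ⟨x, hx, y, hy, hxy⟩ := hadj (σ 1)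
  refine hg.not_separated_of_le hG (Z := X₀ ∪ Y (σ 1)) (z' := q (σ 1))
    (connected_induce_union h0.preconnected (hY _).connected.preconnected hx hy hxy)
    (hY (σ 0)) (hY (σ 2)) (Set.disjoint_union_left.2 ⟨hd0 _, hd _ _ h01.symm⟩)
    (Set.disjoint_union_left.2 ⟨hd0 _, hd _ _ h12⟩) (Or.inl hz) (hq _) (Or.inr (hq _)) (hq _)
    hmin (hσ (by decide)) (hσ (by decide))

/-- The circular order can be cut open so that `X` contains the leftmost vertex and lies to the
left of a given vertex outside `X`. -/
lemma NonCrossing.exists_rotate_before [Finite V] (hf : NonCrossing G f) {X : Set V}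
    (hX : X.Nonempty) {y : V} (hy : y ∉ X) :
    ∃ f' : V → ℝ, NonCrossing G f' ∧ ∃ x ∈ X, (∀ v, f' x ≤ f' v) ∧ ∀ v ∈ X, f' v < f' y := by
  obtain ⟨g, hg, hmin, -⟩ := hf.exists_rotate_min y
  obtain ⟨x, hx, hxmin⟩ := X.exists_min_image g X.toFinite hX
  obtain ⟨g', hg', hmin', hlt'⟩ := hg.exists_rotate_min x
  refine ⟨g', hg', x, hx, hmin', fun v hv => (hlt' v y).2 (Or.inl ⟨hxmin v hv, ?_⟩)⟩
  exact lt_of_le_of_ne (hmin x) fun h => hy (hg.injective h ▸ hx)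

theorem NonCrossing.not_supports_two [Finite V] (hf : NonCrossing G f) {k : ℕ}
    (hG : ∀ u v, ∃ p : G.Walk u v, p.length ≤ 2 * k) {X Y : Set V} (hX : Supports G k X)
    (hY : Supports G k Y) (hXY : Disjoint X Y) : False := by
  obtain ⟨y₀, hy₀⟩ := hY.nonempty
  obtain ⟨g, hg, x₀, hx₀, hmin, hlt⟩ := hf.exists_rotate_before hX.nonempty
    (fun h => Set.disjoint_left.1 hXY h hy₀)
  have ne : ∀ {x y}, x ∈ X → y ∈ Y → g x ≠ g y := fun hx hy h =>
    Set.disjoint_left.1 hXY hx (hg.injective h ▸ hy)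
  have hbefore : ∀ x ∈ X, ∀ y ∈ Y, g x < g y := by
    intro x hx y hy
    by_contra! hle
    exact hg.not_interlaced hX.connected hY.connected hXY hx₀ hy hx hy₀
      (lt_of_le_of_ne (hmin y) (ne hx₀ hy)) (lt_of_le_of_ne hle (ne hx hy).symm) (hlt x hx)
  obtain ⟨a, ha⟩ := hX.exists_deep hg
  obtain ⟨b, hb⟩ := hY.exists_deep hg
  obtain ⟨p, hp⟩ := hG a b
  have hdisj : Disjoint (hull g X) (hull g Y) := by
    refine disjoint_hull ?_ ?_
    · rintro y hy ⟨-, x, hx, hyx⟩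
      exact absurd (hbefore x hx y hy) (not_lt.2 hyx)
    · rintro x hx ⟨⟨y, hy, hyx⟩, -⟩
      exact absurd (hbefore x hx y hy) (not_lt.2 hyx)
  have := ha.length_of_disjoint hb hdisj p
  omega

theorem NonCrossing.not_supports_four [Finite V] (hf : NonCrossing G f) {k : ℕ}
    (hG : ∀ u v, ∃ p : G.Walk u v, p.length ≤ 2 * k + 1) {X : Fin 4 → Set V}
    (hX : ∀ i, Supports G k (X i)) (hd : ∀ i j, i ≠ j → Disjoint (X i) (X j)) : False := by
  obtain ⟨y₀, hy₀⟩ := (hX 1).nonempty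
  obtain ⟨g, hg, x₀, hx₀, hmin, hlt⟩ := hf.exists_rotate_before (hX 0).nonempty
    (fun h => Set.disjoint_left.1 (hd 0 1 (by decide)) h hy₀)
  have ne : ∀ {i j x y}, i ≠ j → x ∈ X i → y ∈ X j → g x ≠ g y := fun hij hx hy h =>
    Set.disjoint_left.1 (hd _ _ hij) hx (hg.injective h ▸ hy)
  have hbefore : ∀ j, j ≠ 0 → ∀ x ∈ X 0, ∀ y ∈ X j, g x < g y := by
    intro j hj x hx y hy
    by_contra! hle
    have h1 := lt_of_le_of_ne (hmin y) (ne hj.symm hx₀ hy)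
    have h2 := lt_of_le_of_ne hle (ne hj hy hx)
    -- The two separated sets need not be disjoint, so `j = 1` is covered.
    exact hg.not_separated hG (hX 0).connected (hX j) (hX 1) (hd _ _ hj.symm)
      (hd _ _ (by decide)) hx₀ hy hx hy₀ h1 h2 (hlt x hx)
  have hout : ∀ i j, i ≠ j → ∀ y ∈ X j, y ∉ hull g (X i) := by
    rintro i j hij y hy ⟨⟨a, ha, hay⟩, a', ha', hya'⟩
    rcases eq_or_ne i 0 with rfl | hi
    · exact absurd (hbefore j hij.symm a' ha' y hy) (not_lt.2 hya')
    rcases eq_or_ne j 0 with rfl | hj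
    · exact absurd (hbefore i hi y hy a ha) (not_lt.2 hay)
    · exact hg.not_separated' hG (hX i).connected (hX 0) (hX j) (hd _ _ hi) (hd _ _ hij)
        ha hx₀ ha' hy (hbefore i hi _ hx₀ _ ha) (lt_of_le_of_ne hay (ne hij ha hy))
        (lt_of_le_of_ne hya' (ne hij.symm hy ha'))
  have hdisj : ∀ i j, i ≠ j → Disjoint (hull g (X i)) (hull g (X j)) := fun i j hij =>
    disjoint_hull (hout i j hij) (hout j i hij.symm)
  choose x hx using fun i => (hX i).exists_deep hg
  obtain ⟨σ, hσ⟩ := hg.exists_strictMono hdisj fun i => (hx i).mem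
  obtain ⟨p, hp⟩ := hG (x (σ 0)) (x (σ 2))
  obtain ⟨q, hq⟩ := hG (x (σ 1)) (x (σ 3))
  by_cases hpq : Disjoint {v | v ∈ p.support} {v | v ∈ q.support}
  · exact hg.not_interlaced p.connected_induce_support q.connected_induce_support hpq
      p.start_mem_support q.start_mem_support p.end_mem_support q.end_mem_support
      (hσ (by decide)) (hσ (by decide)) (hσ (by decide))
  · obtain ⟨v, hvp, hvq⟩ := Set.not_disjoint_iff.1 hpq
    -- The common vertex `v` lies in at most one of the four hulls, so one of the two walks has it
    -- outside both of its end hulls and is too long.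
    have hv : ∀ i j, i ≠ j → v ∈ hull g (X (σ i)) → v ∉ hull g (X (σ j)) := fun i j hij h =>
      Set.disjoint_left.1 (hdisj _ _ (σ.injective.ne hij)) h
    by_cases h : v ∉ hull g (X (σ 0)) ∧ v ∉ hull g (X (σ 2))
    · have := (hx _).length_of_mem_support (hx _) p hvp h.1 h.2
      omega
    · have h' : v ∉ hull g (X (σ 1)) ∧ v ∉ hull g (X (σ 3)) := by
        rw [not_and_or, not_not, not_not] at h
        rcases h with h | h <;> exact ⟨hv _ _ (by decide) h, hv _ _ (by decide) h⟩
      have := (hx _).length_of_mem_support (hx _) q hvq h'.1 h'.2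
      omega

end OPDI

/-! ### From minor models to supporting sets. -/

namespace OPDI

open SimpleGraph

/-- The branch sets `β` form a model of `H` as a minor of `G`. -/
def IsModel {W V : Type*} (H : SimpleGraph W) (G : SimpleGraph V) (β : W → Set V) : Prop :=
  (∀ w, (G.induce (β w)).Connected) ∧
  (∀ w w', w ≠ w' → Disjoint (β w) (β w')) ∧
  (∀ w w', H.Adj w w' → ∃ x ∈ β w, ∃ y ∈ β w', G.Adj x y)

section Models

variable {V : Type*} {G : SimpleGraph V}

lemma IsModel.comp {W W' : Type*} {H : SimpleGraph W} {H' : SimpleGraph W'} {β : W → Set V}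
    (h : IsModel H G β) {φ : W' → W} (hφ : Function.Injective φ)
    (hadj : ∀ a b, H'.Adj a b → H.Adj (φ a) (φ b)) : IsModel H' G (β ∘ φ) :=
  ⟨fun _ => h.1 _, fun _ _ hne => h.2.1 _ _ (hφ.ne hne), fun _ _ hab => h.2.2 _ _ (hadj _ _ hab)⟩

lemma IsModel.disjointUnion {i : ℕ} {F : Fin i → Gr} {β : (disjointUnion F).V → Set V}
    (h : IsModel (disjointUnion F).graph G β) (j : Fin i) :
    IsModel (F j).graph G fun v => β ⟨j, v⟩ :=
  h.comp (φ := fun v => (⟨j, v⟩ : (OPDI.disjointUnion F).V))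
    (fun _ _ e => sigma_mk_injective (β := fun j => (F j).V) e)
    fun a b hab => ⟨j, a, b, rfl, rfl, hab⟩

lemma IsModel.disjoint_iUnion {i : ℕ} {F : Fin i → Gr} {β : (OPDI.disjointUnion F).V → Set V}
    (h : IsModel (OPDI.disjointUnion F).graph G β) {j j' : Fin i} (hj : j ≠ j') :
    Disjoint (⋃ v, β ⟨j, v⟩) (⋃ v, β ⟨j', v⟩) := by
  simp only [Set.disjoint_iUnion_left, Set.disjoint_iUnion_right]
  exact fun a b => h.2.1 _ _ fun e => hj (congrArg Sigma.fst e)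

lemma IsModel.joinVertex {i : ℕ} {F : Fin i → Gr} {a : ∀ j, (F j).V}
    {β : (joinVertex F a).V → Set V} (h : IsModel (joinVertex F a).graph G β) :
    IsModel (OPDI.disjointUnion F).graph G fun v => β (some v) :=
  h.comp (φ := fun v => (some v : (OPDI.joinVertex F a).V)) (Option.some_injective _)
    fun p q hpq => Or.inl ⟨p, q, rfl, rfl, hpq⟩

/-- The index is `k + 1` because `Supports` starts at `K₁`, one level below `K13`. -/
theorem supports_of_mem_famB {k : ℕ} {H : Gr} (hH : H ∈ famB (2 * k + 1)) {β : H.V → Set V}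
    (h : IsModel H.graph G β) : Supports G (k + 1) (⋃ v, β v) := by
  induction k generalizing H with
  | zero =>
    obtain rfl : H = K13 := hH
    refine ⟨β (Sum.inl 0), fun i => β (Sum.inr i), ?_, h.1 _, fun i => h.1 _,
      fun i => h.2.1 _ _ Sum.inl_ne_inr, fun i j hij => h.2.1 _ _ fun e => hij (Sum.inr_injective e),
      fun i => h.2.2 _ _ (Or.inl ⟨rfl, rfl⟩)⟩
    refine (Set.iUnion_sum (s := β)).trans ?_
    congr 1
    exact iSup_unique (f := fun a : Fin 1 => β (Sum.inl a))
  | succ k ih =>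
    have hH' : H ∈ joinCopies 3 (famB (2 * k + 1)) := by
      have e : famB (2 * (k + 1) + 1) = joinCopies 3 (famB (2 * k + 1)) := by
        rw [show 2 * (k + 1) + 1 = (2 * k + 1) + 2 by ring, famB, if_neg (by omega)]
      rwa [← e]
    obtain ⟨F, a, hF, rfl⟩ := hH'
    have hU := h.joinVertex
    refine ⟨β none, fun j => ⋃ v, β (some ⟨j, v⟩), ?_, h.1 _,
      fun j => ih (hF j) (hU.disjointUnion j), fun j => ?_,
      fun j j' hj => hU.disjoint_iUnion hj, fun j => ?_⟩
    · refine (Set.iUnion_option β).trans ?_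
      congr 1
      exact Set.iUnion_sigma (fun v => β (some v))
    · rw [Set.disjoint_iUnion_right]
      exact fun v => h.2.1 _ _ (by rintro ⟨⟩)
    · obtain ⟨x, hx, y, hy, hxy⟩ := h.2.2 none (some ⟨j, a j⟩) (Or.inr (Or.inl ⟨j, rfl, rfl⟩))
      exact ⟨x, hx, y, Set.mem_iUnion.2 ⟨_, hy⟩, hxy⟩

theorem exists_supports_of_mem_famA {k : ℕ} {H : Gr} (hH : H ∈ famA (2 * k)) {β : H.V → Set V}
    (h : IsModel H.graph G β) : ∃ X : Fin 2 → Set V, (∀ i, Supports G k (X i)) ∧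
      (∀ i j, i ≠ j → Disjoint (X i) (X j)) ∧ ∀ i, X i ⊆ ⋃ v, β v := by
  cases k with
  | zero =>
    obtain rfl : H = twoK1 := hH
    exact ⟨β, h.1, h.2.1, fun i => Set.subset_iUnion β i⟩
  | succ k =>
    have hH' : H ∈ copies 2 (famB (2 * k + 1)) := by
      have e : famA (2 * (k + 1)) = copies 2 (famB (2 * k + 1)) := by
        rw [show 2 * (k + 1) = (2 * k + 1) + 1 by ring, famA, if_pos (by omega)]
      rwa [← e]
    obtain ⟨F, hF, rfl⟩ := hH'
    exact ⟨fun j => ⋃ v, β ⟨j, v⟩, fun j => supports_of_mem_famB (hF j) (h.disjointUnion j),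
      fun i j hij => h.disjoint_iUnion hij,
      fun j => Set.iUnion_subset fun v => Set.subset_iUnion β ⟨j, v⟩⟩

/-- Odd members are two copies of an even one, and each copy contributes two sets. -/
theorem exists_four_supports_of_mem_famA {k : ℕ} {H : Gr} (hH : H ∈ famA (2 * k + 1))
    {β : H.V → Set V} (h : IsModel H.graph G β) : ∃ X : Fin 4 → Set V,
      (∀ i, Supports G k (X i)) ∧ ∀ i j, i ≠ j → Disjoint (X i) (X j) := by
  have hH' : H ∈ copies 2 (famA (2 * k)) := by
    have e : famA (2 * k + 1) = copies 2 (famA (2 * k)) := by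
      rw [famA, if_neg (by omega)]
    rwa [← e]
  obtain ⟨F, hF, rfl⟩ := hH'
  choose X hX hd hsub using fun j => exists_supports_of_mem_famA (hF j) (h.disjointUnion j)
  let e : Fin 4 ≃ Fin 2 × Fin 2 := (finProdFinEquiv (m := 2) (n := 2)).symm
  refine ⟨fun i => X (e i).1 (e i).2, fun i => hX _ _, fun i j hij => ?_⟩
  by_cases h1 : (e i).1 = (e j).1
  · have h2 : (e i).2 ≠ (e j).2 := fun h2 => hij (e.injective (Prod.ext h1 h2))
    simp only [h1]
    exact hd _ _ _ h2
  · exact (h.disjoint_iUnion h1).mono (hsub _ _) (hsub _ _)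

lemma famB_two_mul (k : ℕ) : famB (2 * k) = ∅ := by
  cases k with
  | zero => rfl
  | succ k => rw [show 2 * (k + 1) = 2 * k + 2 by ring, famB, if_pos (by omega)]

lemma exists_walk_of_ediam_lt {n : ℕ} (h : ¬ ((n + 1 : ℕ) : ℕ∞) ≤ G.ediam) (u v : V) :
    ∃ p : G.Walk u v, p.length ≤ n := by
  have hlt : G.edist u v < ((n + 1 : ℕ) : ℕ∞) := edist_le_ediam.trans_lt (not_le.1 h)
  obtain ⟨p, hp⟩ := exists_walk_of_edist_ne_top hlt.ne_top
  rw [← hp] at hlt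
  exact ⟨p, Nat.lt_succ_iff.1 (by exact_mod_cast hlt)⟩

theorem IsOuterplanar.le_ediam [Finite V] (hG : IsOuterplanar G) {D : ℕ} {H : Gr}
    (hH : H ∈ famA D ∪ famB D) (h : IsMinor H.graph G) : ((D + 1 : ℕ) : ℕ∞) ≤ G.ediam := by
  by_contra hlt
  have hwalk := exists_walk_of_ediam_lt hlt
  obtain ⟨f, hf⟩ := hG.exists_nonCrossing
  obtain ⟨β, hβ⟩ := h
  obtain ⟨k, rfl | rfl⟩ := Nat.even_or_odd' D
  · rw [famB_two_mul, Set.union_empty] at hH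
    obtain ⟨X, hX, hd, -⟩ := exists_supports_of_mem_famA hH hβ
    exact hf.not_supports_two hwalk (hX 0) (hX 1) (hd _ _ (by decide))
  · rcases hH with hH | hH
    · obtain ⟨X, hX, hd⟩ := exists_four_supports_of_mem_famA hH hβ
      exact hf.not_supports_four hwalk hX hd
    · exact hf.not_supports_succ hwalk (supports_of_mem_famB hH hβ)

lemma IsMinor.mono {W : Type*} {H : SimpleGraph W} {G' : SimpleGraph V} (h : IsMinor H G)
    (hG : G ≤ G') : IsMinor H G' := by
  obtain ⟨β, h1, h2, h3⟩ := h
  refine ⟨β, fun w => (h1 w).mono fun x y hxy => hG hxy, h2, fun w w' hw => ?_⟩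
  obtain ⟨x, hx, y, hy, hxy⟩ := h3 w w' hw
  exact ⟨x, hx, y, hy, hG hxy⟩

lemma isMinor_refl (G : SimpleGraph V) : IsMinor G G := by
  refine ⟨fun v => {v}, fun v => ?_, fun v w h => Set.disjoint_singleton.2 h,
    fun v w h => ⟨v, rfl, w, rfl, h⟩⟩
  exact { preconnected := Preconnected.of_subsingleton, nonempty := inferInstance }

theorem lt_opdi [Finite V] {D : ℕ} {H : Gr} (hH : H ∈ famA D ∪ famB D)
    (h : IsMinor H.graph G) : (D : ℕ∞) < opdi G := by
  refine lt_of_lt_of_le (b := ((D + 1 : ℕ) : ℕ∞)) (by exact_mod_cast Nat.lt_succ_self D)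
    (le_sInf ?_)
  rintro _ ⟨G', hG', hout, rfl⟩
  exact hout.le_ediam hH (h.mono hG')

end Models

/-! ### Finiteness of the obstructions, and the theorem. -/

lemma finite_disjointUnion {i : ℕ} {F : Fin i → Gr} (h : ∀ j, Finite (F j).V) :
    Finite (disjointUnion F).V :=
  inferInstanceAs (Finite (Σ j, (F j).V))

lemma finite_of_mem_famB {D : ℕ} {H : Gr} (hH : H ∈ famB D) : Finite H.V := by
  induction D using Nat.strong_induction_on generalizing H with
  | _ D ih =>
    match D with
    | 0 => exact hH.elim
    | 1 =>
      obtain rfl : H = K13 := hH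
      exact inferInstanceAs (Finite (Fin 1 ⊕ Fin 3))
    | i + 2 =>
      rw [famB] at hH
      split_ifs at hH
      · exact hH.elim
      · obtain ⟨F, a, hF, rfl⟩ := hH
        have := finite_disjointUnion fun j => ih i (by omega) (hF j)
        exact inferInstanceAs (Finite (Option (disjointUnion F).V))

lemma finite_of_mem_famA {D : ℕ} {H : Gr} (hH : H ∈ famA D) : Finite H.V := by
  induction D generalizing H with
  | zero =>
    obtain rfl : H = twoK1 := hH
    exact inferInstanceAs (Finite (Fin 2))
  | succ i ih =>
    rw [famA] at hH
    split_ifs at hH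
    · obtain ⟨F, hF, rfl⟩ := hH
      exact finite_disjointUnion fun j => finite_of_mem_famB (hF j)
    · obtain ⟨F, hF, rfl⟩ := hH
      exact finite_disjointUnion fun j => ih (hF j)

end OPDI

theorem mainTheorem6 (D : ℕ) :
    (∀ {V : Type*} [Finite V] (G : SimpleGraph V), OPDI.IsOuterplanar G →
      (∃ H ∈ OPDI.famA D ∪ OPDI.famB D, OPDI.IsMinor H.graph G) →
        ((D + 1 : ℕ) : ℕ∞) ≤ G.ediam ∧ (D : ℕ∞) < OPDI.opdi G) ∧
    (∀ H ∈ OPDI.famA D ∪ OPDI.famB D, (D : ℕ∞) < OPDI.opdi H.graph) := by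
  refine ⟨?_, fun H hH => ?_⟩
  · rintro V _ G hG ⟨H, hH, h⟩
    exact ⟨hG.le_ediam hH h, OPDI.lt_opdi hH h⟩
  · have : Finite H.V := hH.elim OPDI.finite_of_mem_famA OPDI.finite_of_mem_famB
    exact OPDI.lt_opdi hH (OPDI.isMinor_refl _)
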